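/- Let $I$ be a nonempty totally ordered set, and let $\theta$ be the order type of $\{0\}+I$. An $\mathrm{LM}_\theta$-algebra is a bounded distributive lattice $A$ with unary operations $\phi_i,\overline{\phi}_i$ ($i\in I$) such that: every $\phi_i$ is an endomorphism of bounded lattices; $\phi_i x\vee\overline{\phi}_i x=1$ and $\phi_i x\wedge\overline{\phi}_i x=0$; $\phi_i\phi_j x=\phi_j x$; $i\le j$ implies $\phi_i x\le\phi_j x$; and if $\phi_i x=\phi_i y$ for all $i\in I$, then $x=y$. Congruences on $A$ are lattice congruences compatible with all $\phi_i,\overline{\phi}_i$; they form a lattice under inclusion, and a congruence is Boolean if it is a complemented element of this lattice. Let $\Theta(a,b)$ be the least congruence containing $(a,b)$. For a filter $F$ of $A$, let $\mathbf{\Theta}(F)$ be the lattice congruence $\{(x,y): x\wedge f=y\wedge f\text{ for some }f\in F\}$, and write $[c)=\{x\in A: c\le x\}$. Let $X(A)$ be the set of prime filters of $A$, put $\sigma(a)=\{P\in X(A): a\in P\}$, and give $X(A)$ the topology with subbasis the sets $\sigma(a)$ and $X(A)\setminus\sigma(a)$, $a\in A$. Let $f_i:X(A)\to X(A)$, $f_i(P)=\phi_i^{-1}(P)$.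 A set $Y\subseteq X(A)$ is semimodal if $\bigcup_{i\in I}f_i(Y)\subseteq Y$. Let $\mathcal{O}_{CS}$ be the family of open sets $G\subseteq X(A)$ whose complement is semimodal, and for $G\in\mathcal{O}_{CS}$ let $\Theta_{OS}(G)$ be the congruence $\{(x,y)\in A\times A:\sigma(y)\,\triangle\,\sigma(x)\subseteq G\}$. Let $A$ be an $\mathrm{LM}_\theta$-algebra and let $a,b\in A$ with $a\le b$. (1) For every $G\subseteq X(A)$ the following conditions are equivalent: (i) $G\in\mathcal{O}_{CS}$, $\Theta(a,b)=\Theta_{OS}(G)$, and $\Theta(a,b)$ is a Boolean congruence; (ii) $G=\bigcup_{i\in I}\sigma(\phi_i b\wedge\overline{\phi}_i a)$, and $G$ is closed in $X(A)$; (iii) there are $n\ge 1$ and $i_1,\dots,i_n\in I$ such that $G=\sigma\bigl(\bigvee_{j=1}^n(\phi_{i_j}b\wedge\overline{\phi}_{i_j}a)\bigr)$ and $\sigma(b)\setminus\sigma(a)\subseteq G$; (iv) $G\in\mathcal{O}_{CS}$, and there are $n\ge 1$ and $i_1,\dots,i_n\in I$ such that $\sigma(b)\setminus\sigma(a)\subseteq\sigma\bigl(\bigvee_{j=1}^n(\phi_{i_j}b\wedge\overline{\phi}_{i_j}a)\bigr)$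 and $\Theta_{OS}(G)=\mathbf{\Theta}\bigl(\bigl[\bigwedge_{j=1}^n(\overline{\phi}_{i_j}b\vee\phi_{i_j}a)\bigr)\bigr)$. (2) Consequently, $\Theta(a,b)$ is Boolean if and only if there are $n\ge 1$ and $i_1,\dots,i_n\in I$ such that $$\bigcup_{i\in I}\sigma(\phi_i b\wedge\overline{\phi}_i a)=\sigma\Bigl(\bigvee_{j=1}^n(\phi_{i_j}b\wedge\overline{\phi}_{i_j}a)\Bigr)\quad\text{and}\quad\sigma(b)\setminus\sigma(a)\subseteq\bigcup_{i\in I}\sigma(\phi_i b\wedge\overline{\phi}_i a).$$ (3) For all finite families $i_1,\dots,i_n\in I$ that satisfy the two conditions in (2), $\Theta(a,b)=\mathbf{\Theta}\bigl(\bigl[\bigwedge_{j=1}^n(\overline{\phi}_{i_j}b\vee\phi_{i_j}a)\bigr)\bigr)$. -/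

import Mathlib

universe u v

set_option linter.unusedSectionVars false

/-- A `θ`-valued Łukasiewicz–Moisil algebra: a bounded distributive lattice `A` with unary
operations `φ i` and `φbar i` indexed by a nonempty chain `I`
(where `θ` is the order type of `{0} + I`). -/
class LMAlgebra (I : Type u) [LinearOrder I] [Nonempty I]
    (A : Type v) [DistribLattice A] [BoundedOrder A] where
  φ : I → BoundedLatticeHom A A
  φbar : I → A → A
  sup_φbar : ∀ (i : I) (x : A), φ i x ⊔ φbar i x = ⊤
  inf_φbar : ∀ (i : I) (x : A), φ i x ⊓ φbar i x = ⊥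
  φ_φ : ∀ (i j : I) (x : A), φ i (φ j x) = φ j x
  φ_mono : ∀ (i j : I), i ≤ j → ∀ x : A, φ i x ≤ φ j x
  determination : ∀ x y : A, (∀ i : I, φ i x = φ i y) → x = y

namespace LMAlgebra

section Congruences

variable (I : Type u) [LinearOrder I] [Nonempty I]
  (A : Type v) [DistribLattice A] [BoundedOrder A] [LMAlgebra I A]

/-- An LM-congruence: a lattice congruence that respects all the operations `φ i` and `φbar i`. -/
structure Congruence extends LatticeCon A where
  map_φ : ∀ (i : I) {x y : A}, r x y → r (φ i x) (φ i y)
  map_φbar : ∀ (i : I) {x y : A}, r x y → r (φbar i x) (φbar i y)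

namespace Congruence

variable {I A}

theorem r_injective : Function.Injective (fun c : Congruence I A => c.r) := by
  rintro ⟨⟨⟨r, _⟩, _, _⟩, _, _⟩ ⟨⟨⟨s, _⟩, _, _⟩, _, _⟩ h
  cases (h : r = s)
  rfl

/-- Congruences are ordered by inclusion, as sets of pairs. -/
instance : PartialOrder (Congruence I A) where
  le c d := ∀ x y : A, c.r x y → d.r x y
  le_refl _ _ _ h := h
  le_trans _ _ _ h k x y hxy := k x y (h x y hxy)
  le_antisymm c d h k :=
    r_injective (funext fun x => funext fun y => propext ⟨h x y, k x y⟩)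

/-- The infimum of a set of congruences is their intersection. -/
instance : InfSet (Congruence I A) where
  sInf S :=
    { r := fun x y => ∀ c ∈ S, c.r x y
      iseqv := ⟨fun x c _ => c.refl x, fun h c hc => c.symm (h c hc),
        fun h k c hc => c.trans (h c hc) (k c hc)⟩
      inf := fun h k c hc => c.inf (h c hc) (k c hc)
      sup := fun h k c hc => c.sup (h c hc) (k c hc)
      map_φ := fun i _ _ h c hc => c.map_φ i (h c hc)
      map_φbar := fun i _ _ h c hc => c.map_φbar i (h c hc) }

/-- The complete lattice of all LM-congruences on `A`, ordered by inclusion. -/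
instance : CompleteLattice (Congruence I A) :=
  completeLatticeOfInf (Congruence I A) fun _ =>
    ⟨fun _ hc _ _ h => h _ hc, fun _ hd x y h c hc => hd hc x y h⟩

/-- A Boolean congruence is a complemented element of the lattice of LM-congruences. -/
def IsBoolean (c : Congruence I A) : Prop := IsComplemented c

end Congruence

variable {A}

/-- `Θ(a, b)`: the least LM-congruence containing the pair `(a, b)`. -/
def principalCon (a b : A) : Congruence I A := sInf {c | c.r a b}

end Congruences

section Filters

variable {A : Type v} [DistribLattice A] [BoundedOrder A]

/-- The lattice congruence associated with a filter `F`: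
`x` and `y` are congruent iff `x ⊓ f = y ⊓ f` for some `f ∈ F`. -/
def filterCon (F : Order.PFilter A) : LatticeCon A where
  r x y := ∃ f ∈ F, x ⊓ f = y ⊓ f
  iseqv :=
    { refl := fun _ => ⟨⊤, Order.PFilter.top_mem, rfl⟩
      symm := fun ⟨f, hf, h⟩ => ⟨f, hf, h.symm⟩
      trans := by
        rintro x y z ⟨f, hf, h⟩ ⟨g, hg, k⟩
        refine ⟨f ⊓ g, Order.PFilter.inf_mem hf hg, ?_⟩
        rw [← inf_assoc, h, inf_right_comm, k, inf_right_comm, inf_assoc] }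
  inf := by
    rintro w x y z ⟨f, hf, h⟩ ⟨g, hg, k⟩
    refine ⟨f ⊓ g, Order.PFilter.inf_mem hf hg, ?_⟩
    rw [inf_inf_inf_comm, h, k, inf_inf_inf_comm]
  sup := by
    rintro w x y z ⟨f, hf, h⟩ ⟨g, hg, k⟩
    refine ⟨f ⊓ g, Order.PFilter.inf_mem hf hg, ?_⟩
    rw [inf_sup_right, inf_sup_right, ← inf_assoc, h, inf_assoc, inf_comm f g, ← inf_assoc y, k,
      inf_assoc z]

variable (A)

/-- `X(A)`: the set of prime filters of `A`. -/
def PrimeFilter : Type v := {P : Order.PFilter A // P.IsPrime}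

variable {A}

/-- `σ(a)`: the set of all prime filters containing `a`. -/
def σ (a : A) : Set (PrimeFilter A) := {P | a ∈ P.1}

/-- The topology on `X(A)` with subbasis the sets `σ(a)` and their complements. -/
instance : TopologicalSpace (PrimeFilter A) :=
  TopologicalSpace.generateFrom {S | ∃ a : A, S = σ a ∨ S = (σ a)ᶜ}

end Filters

section DualSpace

variable {I : Type u} [LinearOrder I] [Nonempty I]
  {A : Type v} [DistribLattice A] [BoundedOrder A] [LMAlgebra I A]

/-- The map `f i : X(A) → X(A)`, which sends a prime filter `P` to its preimage under `φ i`. -/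
def dualMap (i : I) (P : PrimeFilter A) : PrimeFilter A :=
  ⟨Order.IsPFilter.toPFilter (F := {x : A | φ i x ∈ P.1}) <|
      .of_def ⟨⊤, by simp⟩
        (fun x hx y hy => ⟨x ⊓ y, by
          simpa using ⟨hx, hy⟩, inf_le_left, inf_le_right⟩)
        (fun {x y} hxy hx => Order.PFilter.mem_of_le
          (OrderHomClass.mono (φ i : BoundedLatticeHom A A) hxy) hx),
    ⟨show Order.IsIdeal {x : A | φ i x ∉ P.1} from
      { IsLowerSet := fun x y hyx hx hy => hx (Order.PFilter.mem_of_le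
          (OrderHomClass.mono (φ i : BoundedLatticeHom A A) hyx) hy)
        Nonempty := by
          obtain ⟨z, hz⟩ := P.2.compl_ideal.Nonempty
          refine ⟨⊥, fun h => hz (Order.PFilter.mem_of_le (bot_le : ⊥ ≤ z) ?_)⟩
          simpa using h
        Directed := fun x hx y hy => ⟨x ⊔ y, by
          intro h
          obtain ⟨z, hz, hxz, hyz⟩ := P.2.compl_ideal.Directed _ hx _ hy
          refine hz (Order.PFilter.mem_of_le (sup_le hxz hyz) ?_)
          simpa using h, le_sup_left, le_sup_right⟩ }⟩⟩

theorem mem_dualMap (i : I) (P : PrimeFilter A) (x : A) :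
    x ∈ (dualMap i P).1 ↔ φ i x ∈ P.1 := Iff.rfl

variable (I)

/-- A set `Y` of prime filters is semimodal if `⋃ i, f i (Y) ⊆ Y`. -/
def Semimodal (Y : Set (PrimeFilter A)) : Prop := (⋃ i : I, dualMap i '' Y) ⊆ Y

variable (A)

/-- The family of all open subsets of `X(A)` whose complements are semimodal. -/
def openCosemimodal : Set (Set (PrimeFilter A)) := {G | IsOpen G ∧ Semimodal I Gᶜ}

variable {I A}

theorem mem_σ_φ (i : I) (P : PrimeFilter A) (x : A) : P ∈ σ (φ i x) ↔ dualMap i P ∈ σ x := Iff.rfl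

theorem mem_σ_inf (P : PrimeFilter A) (x y : A) : P ∈ σ (x ⊓ y) ↔ P ∈ σ x ∧ P ∈ σ y :=
  Order.PFilter.inf_mem_iff

theorem mem_σ_sup (P : PrimeFilter A) (x y : A) : P ∈ σ (x ⊔ y) ↔ P ∈ σ x ∨ P ∈ σ y := by
  refine ⟨fun h => ?_, ?_⟩
  · by_contra! hn
    obtain ⟨z, hz, hxz, hyz⟩ := P.2.compl_ideal.Directed _ hn.1 _ hn.2
    exact hz (Order.PFilter.mem_of_le (sup_le hxz hyz) h)
  · rintro (h | h)
    exacts [Order.PFilter.mem_of_le le_sup_left h, Order.PFilter.mem_of_le le_sup_right h]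

theorem mem_σ_φbar (i : I) (P : PrimeFilter A) (x : A) :
    P ∈ σ (φbar i x) ↔ dualMap i P ∉ σ x := by
  rw [← mem_σ_φ]
  constructor
  · intro h k
    have hb : P ∈ σ (⊥ : A) := by
      rw [← inf_φbar i x, mem_σ_inf]
      exact ⟨k, h⟩
    obtain ⟨z, hz⟩ := P.2.compl_ideal.Nonempty
    exact hz (Order.PFilter.mem_of_le (bot_le : ⊥ ≤ z) hb)
  · intro h
    have ht : P ∈ σ (⊤ : A) := Order.PFilter.top_mem
    rw [← sup_φbar i x, mem_σ_sup] at ht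
    exact ht.resolve_left h

theorem dualMap_notMem {G : Set (PrimeFilter A)} (hG : G ∈ openCosemimodal I A) (i : I)
    {P : PrimeFilter A} (hP : P ∉ G) : dualMap i P ∉ G :=
  hG.2 (Set.mem_iUnion.2 ⟨i, P, hP, rfl⟩)

theorem symmDiff_subset_iff {S T G : Set (PrimeFilter A)} :
    symmDiff T S ⊆ G ↔ ∀ P ∉ G, P ∈ S ↔ P ∈ T := by
  simp only [Set.subset_def, Set.mem_symmDiff]
  exact forall_congr' fun P => by tauto

/-- `Θ_OS(G)`, for `G` open with semimodal complement: the congruence of all pairs `(x, y)`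
such that the symmetric difference of `σ(y)` and `σ(x)` is contained in `G`. -/
def ΘOS (G : Set (PrimeFilter A)) (hG : G ∈ openCosemimodal I A) : Congruence I A where
  r x y := symmDiff (σ y) (σ x) ⊆ G
  iseqv := by
    simp only [symmDiff_subset_iff]
    exact ⟨fun _ _ _ => Iff.rfl, fun h P hP => (h P hP).symm,
      fun h k P hP => (h P hP).trans (k P hP)⟩
  inf h k := by
    simp only [symmDiff_subset_iff, mem_σ_inf] at *
    exact fun P hP => and_congr (h P hP) (k P hP)
  sup h k := by
    simp only [symmDiff_subset_iff, mem_σ_sup] at *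
    exact fun P hP => or_congr (h P hP) (k P hP)
  map_φ i x y h := by
    simp only [symmDiff_subset_iff, mem_σ_φ] at *
    exact fun P hP => h _ (dualMap_notMem hG i hP)
  map_φbar i x y h := by
    simp only [symmDiff_subset_iff, mem_σ_φbar] at *
    exact fun P hP => not_congr (h _ (dualMap_notMem hG i hP))

end DualSpace

end LMAlgebra

namespace LMAlgebra

/-! ### Prime filters: separation, a base of the topology, compactness. -/

section PrimeFilters

variable {A : Type v} [DistribLattice A] [BoundedOrder A]

/-! Let `U` be the union of the sets `σ (φ i b ⊓ φbar i a)`: the prime filters some `dualMap i` of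
which lies in `σ b \ σ a`. Since `dualMap i ∘ dualMap j = dualMap i`, membership in `U` is invariant
under every `dualMap`. The support of `Θ(a, b)` lies between `U` and `(σ b \ σ a) ∪ U`. If `Θ(a, b)`
is Boolean, its support is the complement of another support, hence clopen and closed under every
`dualMap`. This forces it to equal `U` (`isClosed_iUnion_of_isBoolean`). Compactness then reduces
`U` to a finite union `σ c`, and the determination axiom yields `σ b \ σ a ⊆ σ c`
(`σ_diff_subset_of_iUnion_eq`). Conversely, that inclusion gives `Θ(a, b) = ΘOS (σ c)`, because `c`
is congruent to `⊥` (`principalCon_eq_ΘOS`). It is complemented by the congruence of `(σ c)ᶜ`, and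
it is a filter congruence by De Morgan. -/

theorem mem_σ_top (P : PrimeFilter A) : P ∈ σ (⊤ : A) := Order.PFilter.top_mem

theorem notMem_σ_bot (P : PrimeFilter A) : P ∉ σ (⊥ : A) := fun h =>
  let ⟨_, hz⟩ := P.2.compl_ideal.Nonempty
  hz (Order.PFilter.mem_of_le bot_le h)

theorem σ_mono {x y : A} (h : x ≤ y) : σ x ⊆ σ y := fun _ hx => Order.PFilter.mem_of_le h hx

/-- Prime ideal theorem: the complement of a prime ideal containing `y` and missing the filter above
`x`. -/
theorem exists_mem_σ_diff {x y : A} (h : ¬ x ≤ y) : ∃ P : PrimeFilter A, P ∈ σ x ∧ P ∉ σ y := by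
  have hd : Disjoint (Order.PFilter.principal x : Set A) (Order.Ideal.principal y : Set A) :=
    Set.disjoint_left.2 fun z hx hy => h (le_trans (show x ≤ z from hx) (show z ≤ y from hy))
  obtain ⟨J, hJ, hyJ, hxJ⟩ := DistribLattice.prime_ideal_of_disjoint_filter_ideal hd
  refine ⟨⟨hJ.compl_filter.toPFilter, ⟨?_⟩⟩, ?_, ?_⟩
  · change Order.IsIdeal ((J : Set A)ᶜ)ᶜ
    rw [compl_compl]
    exact J.isIdeal
  · exact Set.disjoint_left.1 hxJ (le_refl x)
  · exact fun hy => hy (hyJ (le_refl y))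

theorem σ_subset_σ_iff {x y : A} : σ x ⊆ σ y ↔ x ≤ y := by
  refine ⟨fun h => ?_, σ_mono⟩
  by_contra hn
  obtain ⟨P, hx, hy⟩ := exists_mem_σ_diff hn
  exact hy (h hx)

theorem σ_injective : Function.Injective (σ : A → Set (PrimeFilter A)) := fun _ _ h =>
  le_antisymm (σ_subset_σ_iff.1 h.subset) (σ_subset_σ_iff.1 h.symm.subset)

theorem mem_σ_finset_sup {ι : Type*} (s : Finset ι) (g : ι → A) (P : PrimeFilter A) :
    P ∈ σ (s.sup g) ↔ ∃ j ∈ s, P ∈ σ (g j) := by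
  classical
  induction s using Finset.induction_on with
  | empty => simpa using notMem_σ_bot P
  | insert j s _ ih => rw [Finset.sup_insert, mem_σ_sup, ih, Finset.exists_mem_insert]

theorem mem_σ_finset_inf {ι : Type*} (s : Finset ι) (g : ι → A) (P : PrimeFilter A) :
    P ∈ σ (s.inf g) ↔ ∀ j ∈ s, P ∈ σ (g j) := by
  classical
  induction s using Finset.induction_on with
  | empty => simpa using mem_σ_top P
  | insert j s _ ih => rw [Finset.inf_insert, mem_σ_inf, ih, Finset.forall_mem_insert]

theorem isOpen_σ (a : A) : IsOpen (σ a) :=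
  TopologicalSpace.isOpen_generateFrom_of_mem ⟨a, .inl rfl⟩

theorem isClosed_σ (a : A) : IsClosed (σ a) :=
  ⟨TopologicalSpace.isOpen_generateFrom_of_mem ⟨a, .inr rfl⟩⟩

/-- The differences `σ u \ σ v` contain the subbasis and are closed under finite intersections, so
they form a base. -/
theorem exists_σ_diff_subset {G : Set (PrimeFilter A)} (hG : IsOpen G) {P : PrimeFilter A}
    (hP : P ∈ G) : ∃ u v : A, P ∈ σ u \ σ v ∧ σ u \ σ v ⊆ G := by
  induction hG with
  | basic S hS =>
    obtain ⟨a, rfl | rfl⟩ := hS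
    · exact ⟨a, ⊥, ⟨hP, notMem_σ_bot P⟩, Set.sdiff_subset⟩
    · exact ⟨⊤, a, ⟨mem_σ_top P, hP⟩, fun Q hQ => hQ.2⟩
  | univ => exact ⟨⊤, ⊥, ⟨mem_σ_top P, notMem_σ_bot P⟩, Set.subset_univ _⟩
  | inter S T _ _ hS hT =>
    obtain ⟨u, v, hP₁, h₁⟩ := hS hP.1
    obtain ⟨w, z, hP₂, h₂⟩ := hT hP.2
    refine ⟨u ⊓ w, v ⊔ z, ?_, fun Q hQ => ?_⟩
    · simp only [Set.mem_sdiff, mem_σ_inf, mem_σ_sup] at *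
      tauto
    · have h₁ := @h₁ Q
      have h₂ := @h₂ Q
      simp only [Set.mem_sdiff, mem_σ_inf, mem_σ_sup, Set.mem_inter_iff] at *
      tauto
  | sUnion K _ ih =>
    obtain ⟨S, hS, hPS⟩ := hP
    obtain ⟨u, v, h, hs⟩ := ih S hS hPS
    exact ⟨u, v, h, hs.trans (Set.subset_sUnion_of_mem hS)⟩

/-- The limit of an ultrafilter on the space of prime filters. -/
def ultrafilterLim (u : Ultrafilter (PrimeFilter A)) : PrimeFilter A :=
  ⟨Order.IsPFilter.toPFilter (F := {x : A | σ x ∈ u}) <|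
      .of_def ⟨⊤, Filter.mem_of_superset Filter.univ_mem fun P _ => mem_σ_top P⟩
        (fun x hx y hy => ⟨x ⊓ y,
          Filter.mem_of_superset (Filter.inter_mem hx hy) fun P hP => (mem_σ_inf P x y).2 hP,
          inf_le_left, inf_le_right⟩)
        (fun {_ _} hxy hx => Filter.mem_of_superset hx (σ_mono hxy)),
    ⟨show Order.IsIdeal {x : A | σ x ∉ u} from
      { IsLowerSet := fun _ _ hyx hx hy => hx (Filter.mem_of_superset hy (σ_mono hyx))
        Nonempty := ⟨⊥, fun h =>
          let ⟨P, hP⟩ := u.nonempty_of_mem h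
          notMem_σ_bot P hP⟩
        Directed := fun x hx y hy => ⟨x ⊔ y, fun h => (Ultrafilter.union_mem_iff.1
          (Filter.mem_of_superset h fun P hP => (mem_σ_sup P x y).1 hP)).elim hx hy,
          le_sup_left, le_sup_right⟩ }⟩⟩

/-- Every ultrafilter converges to its `ultrafilterLim`; it suffices to check subbasic
neighbourhoods. -/
instance : CompactSpace (PrimeFilter A) where
  isCompact_univ := by
    rw [isCompact_iff_ultrafilter_le_nhds]
    refine fun u _ => ⟨ultrafilterLim u, trivial, ?_⟩
    rw [TopologicalSpace.nhds_generateFrom]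
    simp only [le_iInf_iff, Filter.le_principal_iff]
    rintro S ⟨hS, a, rfl | rfl⟩
    · exact hS
    · exact Ultrafilter.compl_mem_iff_notMem.2 hS

end PrimeFilters

/-! ### Congruences versus open sets with semimodal complement. -/

section Dual

variable {I : Type u} [LinearOrder I] [Nonempty I]
  {A : Type v} [DistribLattice A] [BoundedOrder A] [LMAlgebra I A]

theorem dualMap_dualMap (i j : I) (P : PrimeFilter A) :
    dualMap i (dualMap j P) = dualMap i P := by
  refine Subtype.ext (SetLike.ext fun x => ?_)
  rw [mem_dualMap, mem_dualMap, mem_dualMap, φ_φ]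

theorem semimodal_iff {Y : Set (PrimeFilter A)} :
    Semimodal I Y ↔ ∀ i : I, ∀ P ∈ Y, dualMap i P ∈ Y := by
  simp only [Semimodal, Set.iUnion_subset_iff, Set.image_subset_iff]
  rfl

theorem ΘOS_r_iff {G : Set (PrimeFilter A)} {hG : G ∈ openCosemimodal I A} {x y : A} :
    (ΘOS G hG).r x y ↔ ∀ P ∉ G, P ∈ σ x ↔ P ∈ σ y := symmDiff_subset_iff

/-- A point of `G` has a neighbourhood `σ u \ σ v ⊆ G`. The pair `(u, u ⊓ v)` is then identified by
`ΘOS G` but separated at that point. Hence the congruence determines `G`. -/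
theorem subset_of_ΘOS_le {G H : Set (PrimeFilter A)} {hG : G ∈ openCosemimodal I A}
    {hH : H ∈ openCosemimodal I A} (h : ΘOS G hG ≤ ΘOS H hH) : G ⊆ H := by
  intro P hP
  obtain ⟨u, v, hPuv, huv⟩ := exists_σ_diff_subset hG.1 hP
  by_contra hPH
  have h₁ : (ΘOS G hG).r u (u ⊓ v) := by
    refine ΘOS_r_iff.2 fun Q hQ => ?_
    have := @huv Q
    rw [mem_σ_inf]
    simp only [Set.mem_sdiff] at this
    tauto
  exact hPuv.2 ((mem_σ_inf P u v).1 ((ΘOS_r_iff.1 (h _ _ h₁) P hPH).1 hPuv.1)).2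

theorem eq_of_ΘOS_eq {G H : Set (PrimeFilter A)} {hG : G ∈ openCosemimodal I A}
    {hH : H ∈ openCosemimodal I A} (h : ΘOS G hG = ΘOS H hH) : G = H :=
  (subset_of_ΘOS_le h.le).antisymm (subset_of_ΘOS_le h.ge)

theorem principalCon_r (a b : A) : (principalCon I a b).r a b := fun _ hc => hc

theorem principalCon_le {a b : A} {c : Congruence I A} (h : c.r a b) : principalCon I a b ≤ c :=
  sInf_le h

/-- The set of all prime filters that separate some pair of congruent elements. -/
def Congruence.support (c : Congruence I A) : Set (PrimeFilter A) :=
  {P | ∃ x y : A, c.r x y ∧ P ∈ σ y \ σ x}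

namespace Congruence

theorem notMem_support_iff {c : Congruence I A} {P : PrimeFilter A} :
    P ∉ c.support ↔ ∀ x y : A, c.r x y → (P ∈ σ x ↔ P ∈ σ y) := by
  constructor
  · intro h x y hxy
    constructor
    · intro hx
      by_contra hy
      exact h ⟨y, x, c.symm hxy, hx, hy⟩
    · intro hy
      by_contra hx
      exact h ⟨x, y, hxy, hy, hx⟩
  · rintro h ⟨x, y, hxy, hy, hx⟩
    exact hx ((h x y hxy).2 hy)

theorem support_mem (c : Congruence I A) : c.support ∈ openCosemimodal I A := by
  constructor
  · rw [isOpen_iff_forall_mem_open]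
    rintro P ⟨x, y, hxy, hP⟩
    exact ⟨σ y \ σ x, fun Q hQ => ⟨x, y, hxy, hQ⟩, (isOpen_σ y).sdiff (isClosed_σ x), hP⟩
  · refine semimodal_iff.2 fun i P hP => ?_
    rw [Set.mem_compl_iff, notMem_support_iff] at *
    exact fun x y hxy => hP _ _ (c.map_φ i hxy)

/-- With `support_subset`, this makes the support the least admissible open set whose congruence
contains `c`. -/
theorem le_ΘOS {c : Congruence I A} {G : Set (PrimeFilter A)} (hG : G ∈ openCosemimodal I A)
    (h : c.support ⊆ G) : c ≤ ΘOS G hG := fun x y hxy =>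
  ΘOS_r_iff.2 fun _ hP => notMem_support_iff.1 (fun hc => hP (h hc)) x y hxy

theorem support_subset {c : Congruence I A} {G : Set (PrimeFilter A)}
    {hG : G ∈ openCosemimodal I A} (h : c ≤ ΘOS G hG) : c.support ⊆ G := by
  rintro P ⟨x, y, hxy, hy, hx⟩
  by_contra hP
  exact hx ((ΘOS_r_iff.1 (h x y hxy) P hP).2 hy)

theorem eq_of_bot_r {x y : A} (h : (⊥ : Congruence I A).r x y) : x = y := by
  let e : Congruence I A :=
    { r := Eq
      iseqv := eq_equivalence
      inf := fun h k => by rw [h, k]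
      sup := fun h k => by rw [h, k]
      map_φ := fun i _ _ h => by rw [h]
      map_φbar := fun i _ _ h => by rw [h] }
  exact (bot_le : ⊥ ≤ e) x y h

theorem top_r (x y : A) : (⊤ : Congruence I A).r x y := by
  let e : Congruence I A :=
    { r := fun _ _ => True
      iseqv := ⟨fun _ => trivial, fun _ => trivial, fun _ _ => trivial⟩
      inf := fun _ _ => trivial
      sup := fun _ _ => trivial
      map_φ := fun _ _ _ _ => trivial
      map_φbar := fun _ _ _ _ => trivial }
  exact (le_top : e ≤ ⊤) x y trivial

theorem eq_top_of_r_bot_top {c : Congruence I A} (h : c.r ⊥ ⊤) : c = ⊤ := by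
  refine top_unique fun x y _ => ?_
  have h₁ : ∀ z : A, c.r ⊥ z := fun z => by simpa using c.inf h (c.refl z)
  exact c.trans (c.symm (h₁ x)) (h₁ y)

/-- At a common point, the witnessing pairs combine into one pair congruent for both `c` and `d`,
hence equal, although the point separates it. -/
theorem disjoint_support {c d : Congruence I A} (h : Disjoint c d) :
    Disjoint c.support d.support := by
  rw [Set.disjoint_left]
  rintro P ⟨x, y, hxy, hy, hx⟩ ⟨u, v, huv, hv, hu⟩
  have hc : c.r ((x ⊔ u) ⊓ (y ⊓ v)) (y ⊓ v) := by
    have := c.inf (c.sup hxy (c.refl u)) (c.refl (y ⊓ v))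
    rwa [inf_eq_right.2 (inf_le_left.trans le_sup_left : y ⊓ v ≤ y ⊔ u)] at this
  have hd : d.r ((x ⊔ u) ⊓ (y ⊓ v)) (y ⊓ v) := by
    have := d.inf (d.sup (d.refl x) huv) (d.refl (y ⊓ v))
    rwa [inf_eq_right.2 (inf_le_right.trans le_sup_right : y ⊓ v ≤ x ⊔ v)] at this
  let e : Congruence I A :=
    { r := fun x y => c.r x y ∧ d.r x y
      iseqv := ⟨fun x => ⟨c.refl x, d.refl x⟩, fun h => ⟨c.symm h.1, d.symm h.2⟩,
        fun h k => ⟨c.trans h.1 k.1, d.trans h.2 k.2⟩⟩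
      inf := fun h k => ⟨c.inf h.1 k.1, d.inf h.2 k.2⟩
      sup := fun h k => ⟨c.sup h.1 k.1, d.sup h.2 k.2⟩
      map_φ := fun i _ _ h => ⟨c.map_φ i h.1, d.map_φ i h.2⟩
      map_φbar := fun i _ _ h => ⟨c.map_φbar i h.1, d.map_φbar i h.2⟩ }
  have he : e ≤ ⊥ := h (fun _ _ h => h.1) (fun _ _ h => h.2)
  have heq : (x ⊔ u) ⊓ (y ⊓ v) = y ⊓ v := eq_of_bot_r (he _ _ ⟨hc, hd⟩)
  have hP : P ∈ σ (y ⊓ v) := (mem_σ_inf P y v).2 ⟨hy, hv⟩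
  rw [← heq, mem_σ_inf, mem_σ_sup] at hP
  exact hP.1.elim hx hu

/-- The congruence of the union of the supports contains both `c` and `d`, so it identifies `⊥` with
`⊤`; no prime filter can lie outside the union. -/
theorem codisjoint_support {c d : Congruence I A} (h : Codisjoint c d) :
    Codisjoint c.support d.support := by
  rw [codisjoint_iff_le_sup]
  have hm : c.support ∪ d.support ∈ openCosemimodal I A := by
    refine ⟨c.support_mem.1.union d.support_mem.1, semimodal_iff.2 fun i P hP => ?_⟩
    rw [Set.mem_compl_iff, Set.mem_union, not_or] at *
    exact ⟨dualMap_notMem c.support_mem i hP.1, dualMap_notMem d.support_mem i hP.2⟩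
  have ht : ⊤ ≤ ΘOS _ hm := h (le_ΘOS hm Set.subset_union_left) (le_ΘOS hm Set.subset_union_right)
  intro P _
  by_contra hP
  exact notMem_σ_bot P ((ΘOS_r_iff.1 (ht _ _ (top_r ⊥ ⊤)) P hP).2 (mem_σ_top P))

theorem IsBoolean.exists_isCompl_support {c : Congruence I A} (h : c.IsBoolean) :
    ∃ d : Congruence I A, IsCompl c.support d.support :=
  let ⟨d, hd⟩ := h
  ⟨d, disjoint_support hd.1, codisjoint_support hd.2⟩

end Congruence

/-- The complement is the congruence of `(σ c)ᶜ`; the join is everything through the chain `⊥ ~ c ~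
⊤`. -/
theorem isBoolean_ΘOS {c : A} (hG : σ c ∈ openCosemimodal I A)
    (hG' : (σ c)ᶜ ∈ openCosemimodal I A) : (ΘOS (σ c) hG).IsBoolean := by
  refine ⟨ΘOS _ hG', ?_, ?_⟩
  · intro d h₁ h₂ x y hxy
    have hσ : σ x = σ y := Set.ext fun P => by
      by_cases hP : P ∈ σ c
      · exact ΘOS_r_iff.1 (h₂ x y hxy) P (not_not.2 hP)
      · exact ΘOS_r_iff.1 (h₁ x y hxy) P hP
    rw [σ_injective hσ]
  · intro d h₁ h₂
    rw [Congruence.eq_top_of_r_bot_top (c := d)]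
    refine d.trans (h₁ ⊥ c (ΘOS_r_iff.2 fun P hP => ?_)) (h₂ c ⊤ (ΘOS_r_iff.2 fun P hP => ?_))
    · exact iff_of_false (notMem_σ_bot P) hP
    · exact iff_of_true (not_not.1 hP) (mem_σ_top P)

end Dual

/-! ### The principal congruence of a pair `a ≤ b`. -/

section Principal

variable {I : Type u} [LinearOrder I] [Nonempty I]
  {A : Type v} [DistribLattice A] [BoundedOrder A] [LMAlgebra I A] {a b : A}

theorem mem_σ_φ_inf_φbar {i : I} {P : PrimeFilter A} :
    P ∈ σ (φ i b ⊓ φbar i a) ↔ dualMap i P ∈ σ b \ σ a := by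
  rw [mem_σ_inf, mem_σ_φ, mem_σ_φbar, Set.mem_sdiff]

theorem mem_iUnion_iff {P : PrimeFilter A} :
    P ∈ (⋃ i : I, σ (φ i b ⊓ φbar i a)) ↔ ∃ i : I, dualMap i P ∈ σ b \ σ a := by
  simp only [Set.mem_iUnion, mem_σ_φ_inf_φbar]

theorem dualMap_mem_iUnion_iff {i : I} {P : PrimeFilter A} :
    dualMap i P ∈ (⋃ i : I, σ (φ i b ⊓ φbar i a)) ↔ P ∈ (⋃ i : I, σ (φ i b ⊓ φbar i a)) := by
  simp only [mem_iUnion_iff, dualMap_dualMap]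

theorem iUnion_mem : (⋃ i : I, σ (φ i b ⊓ φbar i a)) ∈ openCosemimodal I A :=
  ⟨isOpen_iUnion fun _ => isOpen_σ _,
    semimodal_iff.2 fun _ _ hP h => hP (dualMap_mem_iUnion_iff.1 h)⟩

theorem σ_diff_union_iUnion_mem :
    (σ b \ σ a) ∪ (⋃ i : I, σ (φ i b ⊓ φbar i a)) ∈ openCosemimodal I A := by
  refine ⟨((isOpen_σ b).sdiff (isClosed_σ a)).union iUnion_mem.1,
    semimodal_iff.2 fun i P hP => ?_⟩
  rw [Set.mem_compl_iff, Set.mem_union, not_or] at *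
  exact ⟨fun h => hP.2 (mem_iUnion_iff.2 ⟨i, h⟩), fun h => hP.2 (dualMap_mem_iUnion_iff.1 h)⟩

theorem ΘOS_r_of_diff_subset (hab : a ≤ b) {G : Set (PrimeFilter A)}
    (hG : G ∈ openCosemimodal I A) (h : σ b \ σ a ⊆ G) : (ΘOS G hG).r a b := by
  refine ΘOS_r_iff.2 fun P hP => ⟨fun h => σ_mono hab h, fun hb => ?_⟩
  by_contra ha
  exact hP (h ⟨hb, ha⟩)

theorem support_principalCon_subset (hab : a ≤ b) :
    (principalCon I a b).support ⊆ (σ b \ σ a) ∪ (⋃ i : I, σ (φ i b ⊓ φbar i a)) :=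
  Congruence.support_subset (hG := σ_diff_union_iUnion_mem)
    (principalCon_le (ΘOS_r_of_diff_subset hab _ Set.subset_union_left))

theorem iUnion_subset_support :
    (⋃ i : I, σ (φ i b ⊓ φbar i a)) ⊆ (principalCon I a b).support := by
  intro P hP
  obtain ⟨i, hi⟩ := mem_iUnion_iff.1 hP
  by_contra h
  exact dualMap_notMem (Congruence.support_mem _) i h ⟨a, b, principalCon_r a b, hi⟩

/-- Complementedness makes the support itself stable under `dualMap`, which excludes the points of
`σ b \ σ a` outside the union. -/
theorem isClosed_iUnion_of_isBoolean (hab : a ≤ b) (h : (principalCon I a b).IsBoolean) :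
    IsClosed (⋃ i : I, σ (φ i b ⊓ φbar i a)) := by
  obtain ⟨d, hd⟩ := h.exists_isCompl_support
  have hc : (principalCon I a b).support = d.supportᶜ := hd.eq_compl
  suffices (principalCon I a b).support ⊆ ⋃ i : I, σ (φ i b ⊓ φbar i a) by
    rw [iUnion_subset_support.antisymm this, hc]
    exact d.support_mem.1.isClosed_compl
  intro P hP
  rcases support_principalCon_subset hab hP with _ | h
  -- Any index serves: the image of `P` stays in the support, and either bound there puts `P` in the
  -- union.
  · obtain ⟨i⟩ := ‹Nonempty I›
    have hi : dualMap i P ∈ (principalCon I a b).support := by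
      rw [hc] at hP ⊢
      exact dualMap_notMem d.support_mem i hP
    rcases support_principalCon_subset hab hi with h | h
    · exact mem_iUnion_iff.2 ⟨i, h⟩
    · exact dualMap_mem_iUnion_iff.1 h
  · exact h

theorem exists_finite_of_isClosed_iUnion (h : IsClosed (⋃ i : I, σ (φ i b ⊓ φbar i a))) :
    ∃ n : ℕ, 1 ≤ n ∧ ∃ i : Fin n → I, (⋃ k : I, σ (φ k b ⊓ φbar k a)) =
      σ (Finset.univ.sup fun j => φ (i j) b ⊓ φbar (i j) a) := by
  classical
  obtain ⟨t, ht⟩ := h.isCompact.elim_finite_subcover _ (fun _ => isOpen_σ _) subset_rfl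
  obtain ⟨k⟩ := ‹Nonempty I›
  -- The finite subcover `t` may be empty; adding an arbitrary `k` ensures `1 ≤ n`.
  refine ⟨(insert k t).card, Finset.card_pos.2 (Finset.insert_nonempty k t),
    fun j => ((insert k t).equivFin.symm j : I), Set.Subset.antisymm (ht.trans ?_) fun P hP => ?_⟩
  · refine Set.iUnion₂_subset fun l hl P hP => (mem_σ_finset_sup _ _ P).2
      ⟨(insert k t).equivFin ⟨l, Finset.mem_insert_of_mem hl⟩, Finset.mem_univ _, ?_⟩
    simpa using hP
  · obtain ⟨j, -, hj⟩ := (mem_σ_finset_sup _ _ P).1 hP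
    exact Set.mem_iUnion.2 ⟨_, hj⟩

/-- The claim amounts to `b ≤ a ⊔ c`. By the determination axiom it may be tested after each `φ i`,
that is, at the points `dualMap i P`, where it holds by the definition of the union. -/
theorem σ_diff_subset_of_iUnion_eq {c : A} (h : (⋃ i : I, σ (φ i b ⊓ φbar i a)) = σ c) :
    σ b \ σ a ⊆ σ c := by
  suffices b ⊓ (a ⊔ c) = b by
    rintro P ⟨hb, ha⟩
    exact ((mem_σ_sup P a c).1 (σ_mono (inf_eq_left.1 this) hb)).resolve_left ha
  refine determination (I := I) _ _ fun i => σ_injective (Set.ext fun P => ?_)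
  have hc : dualMap i P ∈ σ c ↔ P ∈ σ c := by rw [← h, dualMap_mem_iUnion_iff]
  rw [mem_σ_φ, mem_σ_φ, mem_σ_inf, mem_σ_sup, hc]
  refine and_iff_left_of_imp fun hb => or_iff_not_imp_left.2 fun ha => ?_
  rw [← h]
  exact mem_iUnion_iff.2 ⟨i, hb, ha⟩

theorem mem_σ_inf_iff_notMem_σ_sup {n : ℕ} (i : Fin n → I) (P : PrimeFilter A) :
    P ∈ σ (Finset.univ.inf fun j => φbar (i j) b ⊔ φ (i j) a) ↔
      P ∉ σ (Finset.univ.sup fun j => φ (i j) b ⊓ φbar (i j) a) := by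
  rw [mem_σ_finset_inf, mem_σ_finset_sup]
  simp only [mem_σ_sup, mem_σ_inf, mem_σ_φ, mem_σ_φbar, Finset.mem_univ, true_and, not_exists,
    forall_const]
  exact forall_congr' fun j => by tauto

/-- If `dualMap k P` lies in `σ b \ σ a`, the inclusion supplies an index `i j`, and `dualMap (i j)
(dualMap k P) = dualMap (i j) P` transfers it to `P`. -/
theorem iUnion_eq_of_diff_subset {n : ℕ} (i : Fin n → I)
    (h : σ b \ σ a ⊆ σ (Finset.univ.sup fun j => φ (i j) b ⊓ φbar (i j) a)) :
    (⋃ k : I, σ (φ k b ⊓ φbar k a)) =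
      σ (Finset.univ.sup fun j => φ (i j) b ⊓ φbar (i j) a) := by
  have h₁ : σ (Finset.univ.sup fun j => φ (i j) b ⊓ φbar (i j) a) ⊆
      ⋃ k : I, σ (φ k b ⊓ φbar k a) := fun P hP =>
    let ⟨_, _, hj⟩ := (mem_σ_finset_sup _ _ P).1 hP
    Set.mem_iUnion.2 ⟨_, hj⟩
  refine Set.Subset.antisymm (fun P hP => ?_) h₁
  obtain ⟨k, hk⟩ := mem_iUnion_iff.1 hP
  obtain ⟨j, hj, hP⟩ := (mem_σ_finset_sup _ _ _).1 (h hk)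
  rw [mem_σ_φ_inf_φbar, dualMap_dualMap, ← mem_σ_φ_inf_φbar] at hP
  exact (mem_σ_finset_sup _ _ _).2 ⟨j, hj, hP⟩

/-- Modulo `Θ(a, b)`, replacing `φbar (i j) a` by `φbar (i j) b` turns each joinand into `⊥`. -/
theorem principalCon_sup_r_bot (a b : A) {n : ℕ} (i : Fin n → I) :
    (principalCon I a b).r (Finset.univ.sup fun j => φ (i j) b ⊓ φbar (i j) a) ⊥ := by
  refine Finset.sup_induction (p := fun x => (principalCon I a b).r x ⊥)
    ((principalCon I a b).refl ⊥) (fun x hx y hy => ?_) fun j _ => ?_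
  · simpa using (principalCon I a b).sup hx hy
  · have h := (principalCon I a b).inf ((principalCon I a b).refl (φ (i j) b))
      ((principalCon I a b).map_φbar (i j) (principalCon_r a b))
    rwa [inf_φbar] at h

theorem filterCon_principal_r_iff {c x y : A} :
    (filterCon (Order.PFilter.principal c)).r x y ↔ ∀ P ∈ σ c, P ∈ σ x ↔ P ∈ σ y := by
  constructor
  · rintro ⟨f, hf, h⟩ P hP
    have hPf : P ∈ σ f := σ_mono hf hP
    have := mem_σ_inf P x f
    rw [h, mem_σ_inf] at this
    tauto
  · intro h
    refine ⟨c, le_refl c, σ_injective (Set.ext fun P => ?_)⟩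
    have := h P
    rw [mem_σ_inf, mem_σ_inf]
    tauto

theorem toLatticeCon_eq_of_r_iff {c d : LatticeCon A} (h : ∀ x y, c.r x y ↔ d.r x y) : c = d := by
  rcases c with ⟨⟨r, _⟩, _, _⟩
  rcases d with ⟨⟨s, _⟩, _, _⟩
  obtain rfl : r = s := funext fun x => funext fun y => propext (h x y)
  rfl

theorem ΘOS_eq_filterCon {n : ℕ} (i : Fin n → I)
    (hG : σ (Finset.univ.sup fun j => φ (i j) b ⊓ φbar (i j) a) ∈ openCosemimodal I A) :
    (ΘOS _ hG).toLatticeCon = filterCon (Order.PFilter.principal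
      (Finset.univ.inf fun j => φbar (i j) b ⊔ φ (i j) a)) := by
  refine toLatticeCon_eq_of_r_iff fun x y => ?_
  rw [filterCon_principal_r_iff]
  simp only [mem_σ_inf_iff_notMem_σ_sup]
  exact ΘOS_r_iff

theorem σ_sup_mem (a b : A) {n : ℕ} (i : Fin n → I) :
    σ (Finset.univ.sup fun j => φ (i j) b ⊓ φbar (i j) a) ∈ openCosemimodal I A ∧
      (σ (Finset.univ.sup fun j => φ (i j) b ⊓ φbar (i j) a))ᶜ ∈ openCosemimodal I A := by
  have h : ∀ (k : I) P, dualMap k P ∈ σ (Finset.univ.sup fun j => φ (i j) b ⊓ φbar (i j) a) ↔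
      P ∈ σ (Finset.univ.sup fun j => φ (i j) b ⊓ φbar (i j) a) := fun k P => by
    simp only [mem_σ_finset_sup, mem_σ_φ_inf_φbar, dualMap_dualMap]
  refine ⟨⟨isOpen_σ _, semimodal_iff.2 fun k P hP hk => hP ((h k P).1 hk)⟩,
    (isClosed_σ _).isOpen_compl, semimodal_iff.2 fun k P hP => ?_⟩
  rw [compl_compl] at *
  exact (h k P).2 hP

/-- Elements that agree off `σ c` have equal joins with `c`, and joining with `c ~ ⊥` changes
nothing modulo `Θ(a, b)`. -/
theorem principalCon_eq_ΘOS (hab : a ≤ b) {n : ℕ} (i : Fin n → I)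
    (h : σ b \ σ a ⊆ σ (Finset.univ.sup fun j => φ (i j) b ⊓ φbar (i j) a)) :
    principalCon I a b = ΘOS _ (σ_sup_mem a b i).1 := by
  refine le_antisymm (principalCon_le (ΘOS_r_of_diff_subset hab _ h)) fun x y hxy => ?_
  set c := Finset.univ.sup fun j => φ (i j) b ⊓ φbar (i j) a
  have hc : (principalCon I a b).r c ⊥ := principalCon_sup_r_bot a b i
  have heq : x ⊔ c = y ⊔ c := σ_injective (Set.ext fun P => by
    have := ΘOS_r_iff.1 hxy P
    rw [mem_σ_sup, mem_σ_sup]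
    tauto)
  have hz : ∀ z, (principalCon I a b).r (z ⊔ c) z := fun z => by
    simpa using (principalCon I a b).sup ((principalCon I a b).refl z) hc
  exact (principalCon I a b).trans ((principalCon I a b).symm (hz x)) (heq ▸ hz y)

theorem isBoolean_principalCon (hab : a ≤ b) {n : ℕ} (i : Fin n → I)
    (h : σ b \ σ a ⊆ σ (Finset.univ.sup fun j => φ (i j) b ⊓ φbar (i j) a)) :
    (principalCon I a b).IsBoolean := by
  rw [principalCon_eq_ΘOS hab i h]
  exact isBoolean_ΘOS _ (σ_sup_mem a b i).2

theorem exists_finite_of_isBoolean (hab : a ≤ b) (h : (principalCon I a b).IsBoolean) :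
    ∃ n : ℕ, 1 ≤ n ∧ ∃ i : Fin n → I, (⋃ k : I, σ (φ k b ⊓ φbar k a)) =
      σ (Finset.univ.sup fun j => φ (i j) b ⊓ φbar (i j) a) ∧
      σ b \ σ a ⊆ σ (Finset.univ.sup fun j => φ (i j) b ⊓ φbar (i j) a) :=
  let ⟨n, hn, i, hi⟩ := exists_finite_of_isClosed_iUnion (isClosed_iUnion_of_isBoolean hab h)
  ⟨n, hn, i, hi, σ_diff_subset_of_iUnion_eq hi⟩

end Principal

end LMAlgebra

/-! ### Assembly of the equivalences. -/

theorem mainTheorem5 {I : Type u} [LinearOrder I] [Nonempty I]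
    {A : Type v} [DistribLattice A] [BoundedOrder A] [LMAlgebra I A]
    (a b : A) (hab : a ≤ b) :
    -- for every set `G` of prime filters, the following four conditions are equivalent
    (∀ G : Set (LMAlgebra.PrimeFilter A), List.TFAE [
      (∃ hG : G ∈ LMAlgebra.openCosemimodal I A,
        LMAlgebra.principalCon I a b = LMAlgebra.ΘOS G hG ∧
          (LMAlgebra.principalCon I a b).IsBoolean),
      (G = (⋃ i : I, LMAlgebra.σ (LMAlgebra.φ i b ⊓ LMAlgebra.φbar i a)) ∧ IsClosed G),
      (∃ n : ℕ, 1 ≤ n ∧ ∃ i : Fin n → I,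
        G = LMAlgebra.σ
          (Finset.univ.sup fun j => LMAlgebra.φ (i j) b ⊓ LMAlgebra.φbar (i j) a) ∧
        LMAlgebra.σ b \ LMAlgebra.σ a ⊆ G),
      (∃ hG : G ∈ LMAlgebra.openCosemimodal I A, ∃ n : ℕ, 1 ≤ n ∧ ∃ i : Fin n → I,
        LMAlgebra.σ b \ LMAlgebra.σ a ⊆
          LMAlgebra.σ
            (Finset.univ.sup fun j => LMAlgebra.φ (i j) b ⊓ LMAlgebra.φbar (i j) a) ∧
        (LMAlgebra.ΘOS G hG).toLatticeCon =
          LMAlgebra.filterCon (Order.PFilter.principal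
            (Finset.univ.inf fun j => LMAlgebra.φbar (i j) b ⊔ LMAlgebra.φ (i j) a)))]) ∧
    -- `Θ(a, b)` is Boolean iff a suitable finite family of indices exists
    ((LMAlgebra.principalCon I a b).IsBoolean ↔
      ∃ n : ℕ, 1 ≤ n ∧ ∃ i : Fin n → I,
        (⋃ k : I, LMAlgebra.σ (LMAlgebra.φ k b ⊓ LMAlgebra.φbar k a)) =
          LMAlgebra.σ
            (Finset.univ.sup fun j => LMAlgebra.φ (i j) b ⊓ LMAlgebra.φbar (i j) a) ∧
        LMAlgebra.σ b \ LMAlgebra.σ a ⊆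
          ⋃ k : I, LMAlgebra.σ (LMAlgebra.φ k b ⊓ LMAlgebra.φbar k a)) ∧
    -- and for every such family `Θ(a, b)` is the congruence of the corresponding filter
    (∀ (n : ℕ) (i : Fin n → I),
      (⋃ k : I, LMAlgebra.σ (LMAlgebra.φ k b ⊓ LMAlgebra.φbar k a)) =
          LMAlgebra.σ
            (Finset.univ.sup fun j => LMAlgebra.φ (i j) b ⊓ LMAlgebra.φbar (i j) a) →
        LMAlgebra.σ b \ LMAlgebra.σ a ⊆
          (⋃ k : I, LMAlgebra.σ (LMAlgebra.φ k b ⊓ LMAlgebra.φbar k a)) →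
        (LMAlgebra.principalCon I a b).toLatticeCon =
          LMAlgebra.filterCon (Order.PFilter.principal
            (Finset.univ.inf fun j => LMAlgebra.φbar (i j) b ⊔ LMAlgebra.φ (i j) a))) := by
  refine ⟨fun G => ?_, ⟨fun h => ?_, ?_⟩, fun n i h₁ h₂ => ?_⟩
  · tfae_have 1 → 3 := by
      rintro ⟨hG, h, hB⟩
      obtain ⟨n, hn, i, -, hd⟩ := LMAlgebra.exists_finite_of_isBoolean hab hB
      rw [LMAlgebra.principalCon_eq_ΘOS hab i hd] at h
      obtain rfl := LMAlgebra.eq_of_ΘOS_eq h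
      exact ⟨n, hn, i, rfl, hd⟩
    tfae_have 3 → 1 := by
      rintro ⟨n, -, i, rfl, hd⟩
      exact ⟨(LMAlgebra.σ_sup_mem a b i).1, LMAlgebra.principalCon_eq_ΘOS hab i hd,
        LMAlgebra.isBoolean_principalCon hab i hd⟩
    tfae_have 2 → 3 := by
      rintro ⟨rfl, hc⟩
      obtain ⟨n, hn, i, hi⟩ := LMAlgebra.exists_finite_of_isClosed_iUnion hc
      exact ⟨n, hn, i, hi, hi ▸ LMAlgebra.σ_diff_subset_of_iUnion_eq hi⟩
    tfae_have 3 → 2 := by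
      rintro ⟨n, -, i, rfl, hd⟩
      exact ⟨(LMAlgebra.iUnion_eq_of_diff_subset i hd).symm, LMAlgebra.isClosed_σ _⟩
    tfae_have 3 → 4 := by
      rintro ⟨n, hn, i, rfl, hd⟩
      exact ⟨(LMAlgebra.σ_sup_mem a b i).1, n, hn, i, hd, LMAlgebra.ΘOS_eq_filterCon i _⟩
    tfae_have 4 → 3 := by
      rintro ⟨hG, n, hn, i, hd, h⟩
      -- The filter congruence is again of the form `ΘOS`, so injectivity of `ΘOS` recovers `G`.
      rw [← LMAlgebra.ΘOS_eq_filterCon i (LMAlgebra.σ_sup_mem a b i).1] at h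
      have h' : LMAlgebra.ΘOS G hG = LMAlgebra.ΘOS _ (LMAlgebra.σ_sup_mem a b i).1 :=
        LMAlgebra.Congruence.r_injective (congrArg (fun c : LatticeCon A => c.r) h)
      obtain rfl := LMAlgebra.eq_of_ΘOS_eq h'
      exact ⟨n, hn, i, rfl, hd⟩
    tfae_finish
  · obtain ⟨n, hn, i, hi, hd⟩ := LMAlgebra.exists_finite_of_isBoolean hab h
    exact ⟨n, hn, i, hi, hi ▸ hd⟩
  · rintro ⟨n, -, i, hi, hd⟩
    exact LMAlgebra.isBoolean_principalCon hab i (hi ▸ hd)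
  · rw [LMAlgebra.principalCon_eq_ΘOS hab i (h₁ ▸ h₂), LMAlgebra.ΘOS_eq_filterCon]
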